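/- A \emph{universe} is a lattice $(\vec U,\le,\vee,\wedge)$ with an order-reversing involution $\vec s\mapsto \vec s^{\,*}$; a \emph{separation system} in it is a subset $\vec S\subseteq\vec U$ closed under $^*$. For $\vec s\in\vec U$ let $s=\{\vec s,\vec s^{\,*}\}$, and let $S=\{s:\vec s\in\vec S\}$. An element $\vec s\in\vec S$ is \emph{trivial} in $\vec S$ if there is $\vec r\in\vec S$ with $r\ne s$, $\vec s\le\vec r$ and $\vec s\le\vec r^{\,*}$; its inverse is then \emph{cotrivial}. A \emph{star} in $\vec S$ is a (possibly empty) set $\sigma\subseteq\vec S$ such that $\vec s\le\vec t^{\,*}$ for all distinct $\vec s,\vec t\in\sigma$. A set $\mathcal F\subseteq 2^{\vec S}$ of stars is \emph{standard for $S$} if $\{\vec s\}\in\mathcal F$ for every cotrivial $\vec s\in\vec S$. An \emph{orientation} of $S$ is a set $O\subseteq\vec S$ containing exactly one element of $s$ for every $s\in S$. It is \emph{consistent} if there are no $\vec r,\vec s\in O$ with $r\neq s$ and $\vec r^{\,*}\le\vec s$. An \emph{$\mathcal F$-tangle} of $S$ is a consistent orientation of $S$ that has no element of $\mathcal F$ as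 a subset. An \emph{$S$-tree} is a pair $(T,\alpha)$ of a finite (nonempty) tree $T$ and a map $\alpha$ from the set of oriented edges of $T$ to $\vec S$ with $\alpha(y,x)=\alpha(x,y)^*$ for every oriented edge $(x,y)$. It is \emph{over $\mathcal F$} if $\{\alpha(x,t): x \text{ a neighbour of } t\}\in\mathcal F$ for every node $t$ of $T$. Let $\vec r,\vec s\in\vec S$. We say that $\vec s$ \emph{emulates $\vec r$ in $\vec S$ for $\mathcal F$} if $\vec s\ge\vec r$; $\vec s\vee\vec t\in\vec S$ for every $\vec t\in\vec S\setminus\{\vec r^{\,*}\}$ with $\vec t\ge\vec r$; and, for every $\sigma\in\mathcal F$ with $\vec r^{\,*}\notin\sigma$ and every $\vec x\in\sigma$ with $\vec x\ge\vec r$, the set $\{\vec x\vee\vec s\}\cup\{\vec y\wedge\vec s^{\,*}:\vec y\in\sigma\setminus\{\vec x\}\}$ lies in $\mathcal F$. An element $\vec r\in\vec S$ is \emph{$\mathcal F$-critical} if $\vec r\in\sigma$ for some $\sigma\in\mathcal F$, but there is no $\sigma'\in\mathcal F$ with $\sigma'\cap\{\vec r,\vec r^{\,*}\}=\{\vec r^{\,*}\}$.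 The system $S$ is \emph{critically $\mathcal F$-separable} if for all $\vec r,\vec r'\in\vec S$ with $\vec r\le\vec r'$ such that $\vec r$ and $\vec r'^{\,*}$ are $\mathcal F$-critical, there is $\vec s_0\in\vec S$ such that $\vec s_0$ emulates $\vec r$ in $\vec S$ for $\mathcal F$ and $\vec s_0^{\,*}$ emulates $\vec r'^{\,*}$ in $\vec S$ for $\mathcal F$. \textbf{Theorem.} Let $U$ be a finite universe, $S\subseteq U$ a separation system, and $\mathcal F\subseteq 2^{\vec S}$ a set of stars such that $\mathcal F$ is standard for $S$ and $S$ is critically $\mathcal F$-separable. Then precisely one of the following holds: (i) there is an $S$-tree over $\mathcal F$; (ii) there is an $\mathcal F$-tangle of $S$. -/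

import Mathlib

namespace TangleTree

/-- A universe of separations: a lattice of oriented separations together with an
order-reversing involution, written `s⁻¹` for the inverse of `s`. -/
class SepUniverse (U : Type*) extends Lattice U, InvolutiveInv U where
  /-- The involution reverses the order. -/
  inv_antitone : ∀ r s : U, r ≤ s → s⁻¹ ≤ r⁻¹

section
variable {U : Type*} [SepUniverse U]

/-- De Morgan's law, a consequence of the axioms. -/
theorem inv_sup_eq (s t : U) : (s ⊔ t)⁻¹ = s⁻¹ ⊓ t⁻¹ := by
  refine le_antisymm (le_inf (SepUniverse.inv_antitone _ _ le_sup_left)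
    (SepUniverse.inv_antitone _ _ le_sup_right)) ?_
  have h : s ⊔ t ≤ (s⁻¹ ⊓ t⁻¹)⁻¹ := by
    refine sup_le ?_ ?_
    · simpa using SepUniverse.inv_antitone _ _ (inf_le_left : s⁻¹ ⊓ t⁻¹ ≤ s⁻¹)
    · simpa using SepUniverse.inv_antitone _ _ (inf_le_right : s⁻¹ ⊓ t⁻¹ ≤ t⁻¹)
  simpa using SepUniverse.inv_antitone _ _ h

/-- The underlying unoriented separation of an oriented separation: the set of its
orientations. -/
def sep (s : U) : Set U := {s, s⁻¹}

/-- A separation system inside the universe, given as its set of oriented separations. -/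
def IsSepSystem (S : Set U) : Prop := ∀ s ∈ S, s⁻¹ ∈ S

/-- `s` is trivial in `S`: some other separation `r` of `S` has both orientations above `s`. -/
def IsTrivialIn (S : Set U) (s : U) : Prop :=
  s ∈ S ∧ ∃ r ∈ S, sep r ≠ sep s ∧ s ≤ r ∧ s ≤ r⁻¹

/-- `s` is cotrivial in `S`: its inverse is trivial in `S`. -/
def IsCotrivialIn (S : Set U) (s : U) : Prop := IsTrivialIn S s⁻¹

/-- A star in `S`: a set of separations in `S` whose distinct elements point towards each other.
The empty set is a star. -/
def IsStar (S : Set U) (σ : Set U) : Prop :=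
  σ ⊆ S ∧ ∀ s ∈ σ, ∀ t ∈ σ, s ≠ t → s ≤ t⁻¹

/-- `F` is standard for `S`: it contains `{s}` for every cotrivial `s`. -/
def IsStandard (S : Set U) (F : Set (Set U)) : Prop :=
  ∀ s ∈ S, IsCotrivialIn S s → {s} ∈ F

/-- An orientation of `S`: a set containing exactly one orientation of each separation of `S`. -/
structure IsOrientation (S O : Set U) : Prop where
  subset : O ⊆ S
  antisymmetric : ∀ s ∈ S, (O ∩ sep s).Subsingleton
  orients : ∀ s ∈ S, s ∈ O ∨ s⁻¹ ∈ O

/-- Consistency: no two elements with distinct underlying separations point away from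
each other. -/
def IsConsistent (O : Set U) : Prop :=
  ∀ r ∈ O, ∀ s ∈ O, ¬ (r⁻¹ ≤ s ∧ sep r ≠ sep s)

/-- An `F`-tangle of `S`: a consistent orientation of `S` that includes no set in `F`. -/
structure IsTangle (S : Set U) (F : Set (Set U)) (O : Set U) : Prop where
  isOrientation : IsOrientation S O
  isConsistent : IsConsistent O
  avoids : ∀ σ ∈ F, ¬ σ ⊆ O

/-- The shift of the star `σ`, with distinguished element `x`, to `s₀`. -/
def shift (σ : Set U) (x s₀ : U) : Set U :=
  insert (x ⊔ s₀) ((fun y => y ⊓ s₀⁻¹) '' (σ \ {x}))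

/-- `s` emulates `r` in `S`. -/
def Emulates (S : Set U) (s r : U) : Prop :=
  r ≤ s ∧ ∀ t ∈ S, t ≠ r⁻¹ → r ≤ t → s ⊔ t ∈ S

/-- `s` emulates `r` in `S` for `F`. -/
def EmulatesFor (S : Set U) (F : Set (Set U)) (s r : U) : Prop :=
  Emulates S s r ∧ ∀ σ ∈ F, r⁻¹ ∉ σ → ∀ x ∈ σ, r ≤ x → shift σ x s ∈ F

/-- `r` is `F`-critical: it lies in a star of `F`, but no star of `F` meets `{r, r⁻¹}` in
exactly `{r⁻¹}`. -/
def IsCritical (F : Set (Set U)) (r : U) : Prop :=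
  (∃ σ ∈ F, r ∈ σ) ∧ ¬ ∃ σ ∈ F, σ ∩ sep r = {r⁻¹}

/-- `S` is critically `F`-separable. -/
def IsCriticallySeparable (S : Set U) (F : Set (Set U)) : Prop :=
  ∀ r ∈ S, ∀ r' ∈ S, IsCritical F r → IsCritical F r'⁻¹ → r ≤ r' →
    ∃ s₀ ∈ S, EmulatesFor S F s₀ r ∧ EmulatesFor S F s₀⁻¹ r'⁻¹

/-- An `S`-tree with node set `V`: a tree together with a labelling of its oriented edges by
elements of `S` that commutes with the inversions. -/
structure STree (S : Set U) (V : Type*) where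
  /-- The underlying tree. -/
  graph : SimpleGraph V
  isTree : graph.IsTree
  /-- The labels of the oriented edges. -/
  label : graph.Dart → U
  label_mem : ∀ e, label e ∈ S
  label_symm : ∀ e, label e.symm = (label e)⁻¹

/-- The set of labels of the oriented edges pointing towards the node `t`. -/
def STree.nodeLabels {S : Set U} {V : Type*} (T : STree S V) (t : V) : Set U :=
  T.label '' {e | e.snd = t}

/-- The `S`-tree is over `F`. -/
def STree.IsOver {S : Set U} {V : Type*} (T : STree S V) (F : Set (Set U)) : Prop :=
  ∀ t, T.nodeLabels t ∈ F

/-- There is a (finite) `S`-tree over `F`. -/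
def ExistsSTreeOver (S : Set U) (F : Set (Set U)) : Prop :=
  ∃ (V : Type) (_ : Finite V) (T : STree S V), T.IsOver F

end

end TangleTree

/-!
Call a separation derivable from `P ⊆ S` if it labels the root edge, pointing out of the tree, of a
finite tree whose nodes carry stars in `F` and whose remaining leaf edges are labelled by elements
of `P`. If some star in `F` consists of separations derivable from `∅`, then gluing their derivation
trees at that star gives an `S`-tree over `F`.

Otherwise take a maximal down-closed partial orientation `P` from whose elements no star in `F` can
be derived in full. If `P` did not orient some `s`, pick minimal unoriented `r ≤ s` and `q ≤ s⁻¹`.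
Both `r` and `q` are critical, and a deduction theorem shows that `r⁻¹` and `q⁻¹` are derivable from
`P`. Separability supplies `s₀` such that `s₀` emulates `r` and `s₀⁻¹` emulates `q`; shifting the
two derivations to `s₀` shows that both `s₀⁻¹` and `s₀` are derivable, which contradicts the choice
of `P`. So `P` orients all of `S`, and it is a tangle.

Conversely, orienting the edges of an `S`-tree over `F` by a tangle gives an orientation of a finite
tree without a sink, which is impossible because a tree has fewer edges than nodes.
-/

namespace TangleTree

section Separations

variable {U : Type*} [SepUniverse U] {S σ : Set U} {r s x y z : U}

theorem inv_le_inv_iff : r⁻¹ ≤ s⁻¹ ↔ s ≤ r :=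
  ⟨fun h => by simpa only [inv_inv] using SepUniverse.inv_antitone _ _ h,
    SepUniverse.inv_antitone _ _⟩

theorem le_inv_comm : r ≤ s⁻¹ ↔ s ≤ r⁻¹ := by
  rw [← inv_le_inv_iff, inv_inv]

theorem inv_le_comm : r⁻¹ ≤ s ↔ s⁻¹ ≤ r := by
  rw [← inv_le_inv_iff, inv_inv]

theorem inv_inf_eq (s t : U) : (s ⊓ t)⁻¹ = s⁻¹ ⊔ t⁻¹ :=
  inv_injective <| by simp only [inv_inv, inv_sup_eq]

theorem sep_eq_sep_iff : sep r = sep s ↔ r = s ∨ r = s⁻¹ := by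
  constructor
  · intro h
    have hr : r ∈ sep s := h ▸ Or.inl rfl
    exact hr
  · rintro (rfl | rfl)
    · rfl
    · rw [sep, sep, inv_inv, Set.pair_comm]

theorem IsStar.le_of_inv_mem (hσ : IsStar S σ) (hy : y ∈ σ) (hx : x⁻¹ ∈ σ) (hne : y ≠ x⁻¹) :
    y ≤ x := by
  simpa only [inv_inv] using hσ.2 y hy _ hx hne

theorem eq_of_le_of_le_inv (hr : r ∈ S) (hnt : ¬ IsTrivialIn S r) (hy : y ∈ S) (hle : r ≤ y)
    (hle_inv : r ≤ y⁻¹) (hne : y ≠ r⁻¹) : y = r := by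
  by_contra hyr
  exact hnt ⟨hr, y, hy, fun h => (sep_eq_sep_iff.1 h).elim hyr hne, hle, hle_inv⟩

theorem IsStar.eq_of_le (hσ : IsStar S σ) (hr : r ∈ S) (hnt : ¬ IsTrivialIn S r) (hy : y ∈ σ)
    (hry : r ≤ y) (hyr : y ≠ r⁻¹) (hz : z ∈ σ) (hrz : r ≤ z) (hzr : z ≠ r⁻¹) : y = z := by
  by_contra hne
  have hyz : y ≤ z⁻¹ := hσ.2 y hy z hz hne
  have hy_eq : y = r :=
    eq_of_le_of_le_inv hr hnt (hσ.1 hy) hry (hrz.trans (le_inv_comm.1 hyz)) hyr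
  have hz_eq : z = r := eq_of_le_of_le_inv hr hnt (hσ.1 hz) hrz (hry.trans hyz) hzr
  exact hne (hy_eq.trans hz_eq.symm)

theorem Emulates.inf_inv_mem (hS : IsSepSystem S) (h : Emulates S s r) (hx : x ∈ S) (hxr : x ≠ r)
    (hle : x ≤ r⁻¹) : x ⊓ s⁻¹ ∈ S := by
  have hsup : s ⊔ x⁻¹ ∈ S := h.2 _ (hS x hx) (inv_injective.ne hxr) (le_inv_comm.1 hle)
  simpa only [inv_sup_eq, inv_inv, inf_comm] using hS _ hsup

variable {F : Set (Set U)}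

theorem IsCritical.ne_inv (h : IsCritical F r) : r ≠ r⁻¹ := by
  intro hr
  obtain ⟨⟨σ, hσ, hrσ⟩, hno⟩ := h
  refine hno ⟨σ, hσ, ?_⟩
  rw [sep, ← hr, Set.pair_eq_singleton, Set.inter_eq_right]
  exact Set.singleton_subset_iff.2 hrσ

theorem IsCritical.singleton_inv_notMem (h : IsCritical F r) : {r⁻¹} ∉ F := fun hF =>
  h.2 ⟨_, hF, Set.inter_eq_left.2 (Set.singleton_subset_iff.2 (Or.inr rfl))⟩

theorem IsCritical.not_isTrivialIn (hS : IsSepSystem S) (hstd : IsStandard S F)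
    (h : IsCritical F r) : ¬ IsTrivialIn S r := fun ht =>
  h.singleton_inv_notMem (hstd _ (hS r ht.1) (by rwa [IsCotrivialIn, inv_inv]))

end Separations

section Derivations

/-- Derivability of `x` from `P` by stars in `F`: there is a rooted tree with stars in `F` at its
nodes, leaf edges labelled by elements of `P`, and root edge labelled by `x`, pointing out of the
tree. -/
inductive Derives {U : Type*} [Inv U] (F : Set (Set U)) (P : Set U) : U → Prop
  | leaf {x : U} : x ∈ P → Derives F P x
  | node {x : U} (σ : Set U) : σ ∈ F → x⁻¹ ∈ σ → (∀ y ∈ σ, y ≠ x⁻¹ → Derives F P y) →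
      Derives F P x

/-- `F` refutes the partial orientation `P`: all elements of some star in `F` are derivable from
`P`. -/
def Refutes {U : Type*} [Inv U] (F : Set (Set U)) (P : Set U) : Prop :=
  ∃ σ ∈ F, ∀ y ∈ σ, Derives F P y

section Inv

variable {U : Type*} [Inv U] {F : Set (Set U)} {P Q : Set U} {r x : U}

theorem Derives.trans (h : ∀ x ∈ P, Derives F Q x) (hx : Derives F P x) : Derives F Q x := by
  induction hx with
  | leaf hp => exact h _ hp
  | node σ hσ hxσ _ ih => exact .node σ hσ hxσ ih

theorem Refutes.of_insert_of_derives (hr : Derives F P r) (h : Refutes F (insert r P)) :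
    Refutes F P := by
  obtain ⟨σ, hσ, hd⟩ := h
  refine ⟨σ, hσ, fun y hy => (hd y hy).trans ?_⟩
  rintro z (rfl | hz)
  exacts [hr, .leaf hz]

theorem Derives.eq_or_of_insert_of_notMem (hr : ∀ σ ∈ F, r ∉ σ) (h : Derives F (insert r P) x) :
    x = r ∨ Derives F P x := by
  induction h with
  | leaf hp => exact hp.imp_right .leaf
  | node σ hσ hxσ _ ih =>
    exact Or.inr <| .node σ hσ hxσ fun y hy hne =>
      (ih y hy hne).resolve_left (ne_of_mem_of_not_mem hy (hr σ hσ))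

theorem Refutes.of_insert_of_notMem (hr : ∀ σ ∈ F, r ∉ σ) (h : Refutes F (insert r P)) :
    Refutes F P := by
  obtain ⟨σ, hσ, hd⟩ := h
  exact ⟨σ, hσ, fun y hy => ((hd y hy).eq_or_of_insert_of_notMem hr).resolve_left
    (ne_of_mem_of_not_mem hy (hr σ hσ))⟩

theorem Derives.refutes (hx : Derives F P x) (hxP : x ∉ P) (hx_inv : Derives F P x⁻¹) :
    Refutes F P := by
  obtain hp | ⟨σ, hσ, -, hd⟩ := hx
  · exact absurd hp hxP
  · refine ⟨σ, hσ, fun y hy => ?_⟩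
    obtain rfl | hne := eq_or_ne y x⁻¹
    exacts [hx_inv, hd y hy hne]

end Inv

theorem Derives.inv_of_mem {U : Type*} [InvolutiveInv U] {F : Set (Set U)} {P σ : Set U} {y : U}
    (hσ : σ ∈ F) (hy : y ∈ σ) (h : ∀ z ∈ σ, z ≠ y → Derives F P z) : Derives F P y⁻¹ :=
  .node σ hσ (by rwa [inv_inv]) (by rwa [inv_inv])

variable {U : Type*} [SepUniverse U] {S : Set U} {F : Set (Set U)} {P : Set U} {r s x : U}

/- If a derivation of `x` uses the leaf `r`, then the labels along the path from that leaf to the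
root edge increase, and running the path backwards derives `r⁻¹` from `x⁻¹`. Two such leaves would
give two elements above `r` in one star, contradicting the nontriviality of `r`. -/
theorem Derives.or_derives_inv (hstar : ∀ σ ∈ F, IsStar S σ) (hr : r ∈ S)
    (hnt : ¬ IsTrivialIn S r) (hne : r ≠ r⁻¹) (h : Derives F (insert r P) x) :
    Derives F P x ∨ (r ≤ x ∧ x ≠ r⁻¹ ∧ (Derives F P x⁻¹ → Derives F P r⁻¹)) := by
  induction h with
  | leaf hp =>
    rcases hp with rfl | hp
    exacts [Or.inr ⟨le_rfl, hne, id⟩, Or.inl (.leaf hp)]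
  | @node x σ hσ hxσ _ ih =>
    by_cases hall : ∀ y ∈ σ, y ≠ x⁻¹ → Derives F P y
    · exact Or.inl (.node σ hσ hxσ hall)
    push Not at hall
    obtain ⟨y, hy, hyx, hyP⟩ := hall
    obtain ⟨hry, hyr, hy_inv⟩ := (ih y hy hyx).resolve_left hyP
    have eq_y : ∀ z ∈ σ, r ≤ z → z ≠ r⁻¹ → z = y := fun z hz hrz hzr =>
      (hstar σ hσ).eq_of_le hr hnt hz hrz hzr hy hry hyr
    refine Or.inr ⟨hry.trans ((hstar σ hσ).le_of_inv_mem hy hxσ hyx), ?_, fun hx_inv => hy_inv ?_⟩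
    · rintro rfl
      rw [inv_inv] at hxσ hyx
      exact hyx (eq_y r hxσ le_rfl hne).symm
    · refine .inv_of_mem hσ hy fun z hz hzy => ?_
      obtain rfl | hzx := eq_or_ne z x⁻¹
      · exact hx_inv
      · exact (ih z hz hzx).resolve_right fun ⟨hrz, hzr, _⟩ => hzy (eq_y z hz hrz hzr)

theorem Refutes.derives_inv (hstar : ∀ σ ∈ F, IsStar S σ) (hr : r ∈ S) (hnt : ¬ IsTrivialIn S r)
    (hne : r ≠ r⁻¹) (hP : ¬ Refutes F P) (h : Refutes F (insert r P)) : Derives F P r⁻¹ := by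
  obtain ⟨σ, hσ, hd⟩ := h
  have hσP : ¬ ∀ y ∈ σ, Derives F P y := fun hall => hP ⟨σ, hσ, hall⟩
  push Not at hσP
  obtain ⟨y, hy, hyP⟩ := hσP
  obtain ⟨hry, hyr, hy_inv⟩ := ((hd y hy).or_derives_inv hstar hr hnt hne).resolve_left hyP
  refine hy_inv (.inv_of_mem hσ hy fun z hz hzy => ?_)
  exact ((hd z hz).or_derives_inv hstar hr hnt hne).resolve_right fun ⟨hrz, hzr, _⟩ =>
    hzy ((hstar σ hσ).eq_of_le hr hnt hz hrz hzr hy hry hyr)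

theorem Derives.inf_inv (hS : IsSepSystem S) (hstar : ∀ σ ∈ F, IsStar S σ) (hPS : P ⊆ S)
    (hdown : ∀ p ∈ P, ∀ q ∈ S, q ≤ p → q ∈ P) (hr : ¬ Derives F P r) (hs : EmulatesFor S F s r)
    (hx : Derives F P x) (hxr : x ≤ r⁻¹) : Derives F P (x ⊓ s⁻¹) := by
  induction hx with
  | @leaf x hp =>
    have hne : x ≠ r := by
      rintro rfl
      exact hr (.leaf hp)
    exact .leaf (hdown x hp _ (hs.1.inf_inv_mem hS (hPS hp) hne hxr) inf_le_left)
  | @node x σ hσ hxσ hd ih =>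
    have hne : r⁻¹ ≠ x⁻¹ := fun h => hr (inv_injective h ▸ .node σ hσ hxσ hd)
    by_cases hrσ : r⁻¹ ∈ σ
    · obtain rfl := le_antisymm hxr ((hstar σ hσ).le_of_inv_mem hrσ hxσ hne)
      exact ih _ hrσ hne le_rfl
    · have root_inv : (x ⊓ s⁻¹)⁻¹ = x⁻¹ ⊔ s := by rw [inv_inf_eq, inv_inv]
      refine .node _ (hs.2 σ hσ hrσ _ hxσ (le_inv_comm.1 hxr)) ?_ ?_
      · exact root_inv ▸ Set.mem_insert _ _
      · rintro y (rfl | ⟨z, ⟨hz, hzx⟩, rfl⟩) hy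
        · exact absurd root_inv.symm hy
        · exact ih z hz hzx (((hstar σ hσ).le_of_inv_mem hz hxσ hzx).trans hxr)

theorem EmulatesFor.derives_inv (hS : IsSepSystem S) (hstar : ∀ σ ∈ F, IsStar S σ) (hPS : P ⊆ S)
    (hdown : ∀ p ∈ P, ∀ q ∈ S, q ≤ p → q ∈ P) (hs : EmulatesFor S F s r) (hr : ¬ Derives F P r)
    (hr_inv : Derives F P r⁻¹) : Derives F P s⁻¹ := by
  have h := hr_inv.inf_inv hS hstar hPS hdown hr hs le_rfl
  rwa [inf_eq_right.2 (inv_le_inv_iff.2 hs.1.1)] at h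

end Derivations

section PartialOrientations

variable {U : Type*} [SepUniverse U] {S : Set U} {F : Set (Set U)} {P : Set U} {q r s : U}

/-- A down-closed partial orientation of `S` without cotrivial elements: a candidate for extension
to a consistent orientation. Degenerate separations `p = p⁻¹` are allowed. -/
structure IsPartialOrientation (S P : Set U) : Prop where
  subset : P ⊆ S
  mem_of_le : ∀ p ∈ P, ∀ q ∈ S, q ≤ p → q ∈ P
  eq_inv_of_inv_mem : ∀ p ∈ P, p⁻¹ ∈ P → p = p⁻¹
  not_isCotrivialIn : ∀ p ∈ P, ¬ IsCotrivialIn S p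

/-- The oriented separations in `S` neither of whose orientations lies in `P`. -/
def unoriented (S P : Set U) : Set U := {s ∈ S | s ∉ P ∧ s⁻¹ ∉ P}

theorem isPartialOrientation_empty : IsPartialOrientation S ∅ where
  subset := Set.empty_subset S
  mem_of_le := fun _ h => h.elim
  eq_inv_of_inv_mem := fun _ h => h.elim
  not_isCotrivialIn := fun _ h => h.elim

theorem inv_mem_unoriented (hS : IsSepSystem S) (h : s ∈ unoriented S P) :
    s⁻¹ ∈ unoriented S P :=
  ⟨hS s h.1, h.2.2, by rw [inv_inv]; exact h.2.1⟩

namespace IsPartialOrientation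

theorem mem_of_lt_minimal (hS : IsSepSystem S) (hP : IsPartialOrientation S P)
    (hr : Minimal (· ∈ unoriented S P) r) (hq : q ∈ S) (hlt : q < r) : q ∈ P := by
  by_contra hqP
  have hq_inv : q⁻¹ ∉ P := fun h =>
    hr.prop.2.2 (hP.mem_of_le _ h _ (hS r hr.prop.1) (inv_le_inv_iff.2 hlt.le))
  exact hr.not_prop_of_lt hlt ⟨hq, hqP, hq_inv⟩

theorem not_isCotrivialIn_of_minimal (hS : IsSepSystem S) (hP : IsPartialOrientation S P)
    (hr : Minimal (· ∈ unoriented S P) r) : ¬ IsCotrivialIn S r := by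
  rintro ⟨-, t, ht, hsep, hle, hle_inv⟩
  have hne : t ≠ r := fun h => hsep (sep_eq_sep_iff.2 (Or.inr (by rw [inv_inv, h])))
  have hlt : t < r := lt_of_le_of_ne (inv_le_inv_iff.1 hle_inv) hne
  have htP : t ∈ P := hP.mem_of_lt_minimal hS hr ht hlt
  exact hr.prop.2.2 (hP.mem_of_le t htP _ (hS r hr.prop.1) hle)

theorem insert_minimal (hS : IsSepSystem S) (hP : IsPartialOrientation S P)
    (hr : Minimal (· ∈ unoriented S P) r) : IsPartialOrientation S (insert r P) where
  subset := Set.insert_subset hr.prop.1 hP.subset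
  mem_of_le := by
    rintro p (rfl | hp) q hq hle
    · exact hle.eq_or_lt.imp_right (hP.mem_of_lt_minimal hS hr hq)
    · exact Or.inr (hP.mem_of_le p hp q hq hle)
  eq_inv_of_inv_mem := by
    rintro p (rfl | hp) (h | h)
    · exact h.symm
    · exact absurd h hr.prop.2.2
    · exact absurd (by rwa [← h, inv_inv]) hr.prop.2.2
    · exact hP.eq_inv_of_inv_mem p hp h
  not_isCotrivialIn := by
    rintro p (rfl | hp)
    exacts [hP.not_isCotrivialIn_of_minimal hS hr, hP.not_isCotrivialIn p hp]

theorem isOrientation (hP : IsPartialOrientation S P) (h : unoriented S P = ∅) :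
    IsOrientation S P where
  subset := hP.subset
  antisymmetric := by
    rintro s - x ⟨hx, rfl | rfl⟩ y ⟨hy, rfl | rfl⟩
    · rfl
    · exact hP.eq_inv_of_inv_mem _ hx hy
    · exact (hP.eq_inv_of_inv_mem _ hy hx).symm
    · rfl
  orients := by
    intro s hs
    by_contra! hsP
    exact Set.eq_empty_iff_forall_notMem.1 h s ⟨hs, hsP⟩

theorem isConsistent (hS : IsSepSystem S) (hP : IsPartialOrientation S P) : IsConsistent P := by
  rintro r hr s hs ⟨hle, hne⟩
  have hr_inv : r⁻¹ ∈ P := hP.mem_of_le s hs _ (hS r (hP.subset hr)) hle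
  have hr_eq : r = r⁻¹ := hP.eq_inv_of_inv_mem r hr hr_inv
  have hsr : s⁻¹ ≤ r := inv_le_comm.1 hle
  have hsep : sep r ≠ sep s⁻¹ := fun h =>
    hne (h.trans (sep_eq_sep_iff.2 (Or.inr rfl)))
  exact hP.not_isCotrivialIn s hs
    ⟨hS s (hP.subset hs), r, hP.subset hr, hsep, hsr, hr_eq ▸ hsr⟩

theorem isTangle (hS : IsSepSystem S) (hP : IsPartialOrientation S P) (h : unoriented S P = ∅)
    (hF : ¬ Refutes F P) : IsTangle S F P where
  isOrientation := hP.isOrientation h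
  isConsistent := hP.isConsistent hS
  avoids := fun σ hσ hsub => hF ⟨σ, hσ, fun _ hy => .leaf (hsub hy)⟩

theorem isCritical_of_minimal (hS : IsSepSystem S) (hstar : ∀ σ ∈ F, IsStar S σ)
    (hP : IsPartialOrientation S P) (hr : Minimal (· ∈ unoriented S P) r) (hrF : ∃ σ ∈ F, r ∈ σ)
    (hrP : ¬ Derives F P r) : IsCritical F r := by
  refine ⟨hrF, ?_⟩
  rintro ⟨σ, hσ, hinter⟩
  have hr_inv : r⁻¹ ∈ σ := (hinter.ge rfl).1
  refine hrP (.node σ hσ hr_inv fun y hy hne => .leaf ?_)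
  have hyr : y ≠ r := by
    rintro rfl
    exact hne (hinter.le ⟨hy, Or.inl rfl⟩)
  exact hP.mem_of_lt_minimal hS hr ((hstar σ hσ).1 hy)
    (((hstar σ hσ).le_of_inv_mem hy hr_inv hne).lt_of_ne hyr)

end IsPartialOrientation

/-- `P` is a maximal partial orientation of `S` among those that `F` does not refute. -/
def IsMaximalUnrefuted (S : Set U) (F : Set (Set U)) (P : Set U) : Prop :=
  Maximal (fun Q => IsPartialOrientation S Q ∧ ¬ Refutes F Q) P

namespace IsMaximalUnrefuted

theorem refutes_insert (hS : IsSepSystem S) (hP : IsMaximalUnrefuted S F P)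
    (hr : Minimal (· ∈ unoriented S P) r) : Refutes F (insert r P) := by
  by_contra hF
  exact hr.prop.2.1 (hP.le_of_ge ⟨hP.prop.1.insert_minimal hS hr, hF⟩ (Set.subset_insert r P)
    (Set.mem_insert r P))

theorem not_derives (hS : IsSepSystem S) (hP : IsMaximalUnrefuted S F P)
    (hr : Minimal (· ∈ unoriented S P) r) : ¬ Derives F P r := fun hd =>
  hP.prop.2 ((hP.refutes_insert hS hr).of_insert_of_derives hd)

theorem isCritical (hS : IsSepSystem S) (hstar : ∀ σ ∈ F, IsStar S σ)
    (hP : IsMaximalUnrefuted S F P) (hr : Minimal (· ∈ unoriented S P) r) : IsCritical F r := by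
  refine hP.prop.1.isCritical_of_minimal hS hstar hr ?_ (hP.not_derives hS hr)
  by_contra! hrF
  exact hP.prop.2 ((hP.refutes_insert hS hr).of_insert_of_notMem hrF)

theorem derives_inv (hS : IsSepSystem S) (hstar : ∀ σ ∈ F, IsStar S σ) (hstd : IsStandard S F)
    (hP : IsMaximalUnrefuted S F P) (hr : Minimal (· ∈ unoriented S P) r) : Derives F P r⁻¹ :=
  have hcrit := hP.isCritical hS hstar hr
  (hP.refutes_insert hS hr).derives_inv hstar hr.prop.1 (hcrit.not_isTrivialIn hS hstd)
    hcrit.ne_inv hP.prop.2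

theorem derives_inv_of_emulatesFor (hS : IsSepSystem S) (hstar : ∀ σ ∈ F, IsStar S σ)
    (hstd : IsStandard S F) (hP : IsMaximalUnrefuted S F P)
    (hr : Minimal (· ∈ unoriented S P) r) (hs : EmulatesFor S F s r) : Derives F P s⁻¹ :=
  hs.derives_inv hS hstar hP.prop.1.subset hP.prop.1.mem_of_le (hP.not_derives hS hr)
    (hP.derives_inv hS hstar hstd hr)

theorem unoriented_eq_empty (hfin : S.Finite) (hS : IsSepSystem S) (hstar : ∀ σ ∈ F, IsStar S σ)
    (hstd : IsStandard S F) (hsep : IsCriticallySeparable S F) (hP : IsMaximalUnrefuted S F P) :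
    unoriented S P = ∅ := by
  by_contra! hne
  obtain ⟨s, hs⟩ := hne
  have hfin' : (unoriented S P).Finite := hfin.subset (Set.sep_subset S _)
  obtain ⟨r, hrs, hr⟩ := hfin'.exists_le_minimal hs
  obtain ⟨q, hqs, hq⟩ := hfin'.exists_le_minimal (inv_mem_unoriented hS hs)
  obtain ⟨s₀, -, hs₀r, hs₀q⟩ := hsep r hr.prop.1 q⁻¹ (hS q hq.prop.1) (hP.isCritical hS hstar hr)
    (by simpa only [inv_inv] using hP.isCritical hS hstar hq) (hrs.trans (le_inv_comm.1 hqs))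
  rw [inv_inv] at hs₀q
  have hd_inv : Derives F P s₀⁻¹ := hP.derives_inv_of_emulatesFor hS hstar hstd hr hs₀r
  have hd : Derives F P s₀ := by
    simpa only [inv_inv] using hP.derives_inv_of_emulatesFor hS hstar hstd hq hs₀q
  have hs₀P : s₀ ∉ P := fun h => hr.prop.2.1 (hP.prop.1.mem_of_le s₀ h r hr.prop.1 hs₀r.1.1)
  exact hP.prop.2 (hd.refutes hs₀P hd_inv)

end IsMaximalUnrefuted

theorem exists_isMaximalUnrefuted (hfin : S.Finite) (hF : ¬ Refutes F ∅) :
    ∃ P, IsMaximalUnrefuted S F P := by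
  have hfin' : {Q | IsPartialOrientation S Q ∧ ¬ Refutes F Q}.Finite :=
    hfin.finite_subsets.subset fun _ hQ => hQ.1.subset
  obtain ⟨P, -, hP⟩ := hfin'.exists_le_maximal ⟨isPartialOrientation_empty, hF⟩
  exact ⟨P, hP⟩

theorem exists_isTangle (hfin : S.Finite) (hS : IsSepSystem S) (hstar : ∀ σ ∈ F, IsStar S σ)
    (hstd : IsStandard S F) (hsep : IsCriticallySeparable S F) (hF : ¬ Refutes F ∅) :
    ∃ O, IsTangle S F O := by
  obtain ⟨P, hP⟩ := exists_isMaximalUnrefuted hfin hF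
  exact ⟨P, hP.prop.1.isTangle hS (hP.unoriented_eq_empty hfin hS hstar hstd hsep) hP.prop.2⟩

end PartialOrientations

section Forests

/-- A finite rooted forest whose nodes `v` carry the label of the edge from `v` to its parent. The
roots are the nodes with parent `none`, so that `Option Node` is the node set of the tree obtained
by joining all roots to the extra node `none`. The depth function witnesses that passing to
parents terminates. -/
structure LabelledForest (U : Type*) where
  Node : Type
  finite : Finite Node
  parent : Node → Option Node
  depth : Option Node → ℕ
  depth_parent_lt : ∀ v, depth (parent v) < depth (some v)
  label : Node → U

namespace LabelledForest

attribute [instance] LabelledForest.finite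

section Graph

variable {U : Type*} (f : LabelledForest U)

/-- The labels of the edges from the children of `a` to `a`. -/
def childLabels (a : Option f.Node) : Set U := f.label '' {v | f.parent v = a}

/-- The tree on `Option f.Node` in which every node of the forest is joined to its parent. -/
def graph : SimpleGraph (Option f.Node) where
  Adj a b := a.map f.parent = some b ∨ b.map f.parent = some a
  symm := ⟨fun _ _ => Or.symm⟩
  loopless := ⟨by
    rintro (_ | v) h
    · simp at h
    · have hv : f.parent v = some v := by simpa using h
      exact (f.depth_parent_lt v).ne (congrArg f.depth hv)⟩

/-- The edge from a node to its parent, oriented upwards. -/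
def upDart (v : f.Node) : f.graph.Dart := ⟨(some v, f.parent v), Or.inl rfl⟩

theorem upDart_injective : Function.Injective f.upDart := fun _ _ h =>
  Option.some_injective _ (congrArg (·.fst) h)

theorem upDart_ne_symm (v w : f.Node) : f.upDart v ≠ (f.upDart w).symm := by
  intro h
  have hv : some v = f.parent w := congrArg (·.fst) h
  have hw : f.parent v = some w := congrArg (·.snd) h
  have hlt := f.depth_parent_lt v
  rw [hv, hw] at hlt
  exact hlt.asymm (f.depth_parent_lt w)

theorem exists_eq_upDart_or_symm (d : f.graph.Dart) :
    ∃ v, d = f.upDart v ∨ d = (f.upDart v).symm := by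
  obtain ⟨⟨a, b⟩, h | h⟩ := d
  · obtain ⟨v, rfl, rfl⟩ := Option.map_eq_some_iff.1 h
    exact ⟨v, Or.inl rfl⟩
  · obtain ⟨v, rfl, rfl⟩ := Option.map_eq_some_iff.1 h
    exact ⟨v, Or.inr rfl⟩

theorem graph_connected : f.graph.Connected := by
  have reachable_none (a : Option f.Node) : f.graph.Reachable a none := by
    induction a using (measure f.depth).wf.induction with
    | _ a ih =>
      cases a with
      | none => rfl
      | some v => exact (f.upDart v).adj.reachable.trans (ih _ (f.depth_parent_lt v))
  exact ⟨fun a b => (reachable_none a).trans (reachable_none b).symm⟩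

theorem card_edgeSet : Nat.card f.graph.edgeSet = Nat.card f.Node := by
  refine (Nat.card_eq_of_bijective
    (fun v => (⟨(f.upDart v).edge, (f.upDart v).edge_mem⟩ : f.graph.edgeSet)) ⟨?_, ?_⟩).symm
  · intro v w h
    obtain h | h := (SimpleGraph.dart_edge_eq_iff _ _).1 (congrArg Subtype.val h)
    · exact f.upDart_injective h
    · exact absurd h (f.upDart_ne_symm v w)
  · rintro ⟨e, he⟩
    induction e using Sym2.ind with
    | _ a b =>
      obtain ⟨v, h | h⟩ := f.exists_eq_upDart_or_symm ⟨(a, b), he⟩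
      · exact ⟨v, Subtype.ext (congrArg SimpleGraph.Dart.edge h).symm⟩
      · exact ⟨v, Subtype.ext ((congrArg SimpleGraph.Dart.edge h).trans
          (SimpleGraph.Dart.edge_symm _)).symm⟩

theorem graph_isTree : f.graph.IsTree :=
  SimpleGraph.isTree_iff_connected_and_card.2
    ⟨f.graph_connected, by rw [card_edgeSet, Finite.card_option]⟩

/-- Every dart is directed either upwards or downwards along the edge from a unique node to its
parent. -/
noncomputable def dartEquiv : f.Node ⊕ f.Node ≃ f.graph.Dart :=
  Equiv.ofBijective (Sum.elim f.upDart fun v => (f.upDart v).symm) <| by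
    constructor
    · refine f.upDart_injective.sumElim ?_ f.upDart_ne_symm
      exact SimpleGraph.Dart.symm_involutive.injective.comp f.upDart_injective
    · intro d
      obtain ⟨v, rfl | rfl⟩ := f.exists_eq_upDart_or_symm d
      exacts [⟨.inl v, rfl⟩, ⟨.inr v, rfl⟩]

end Graph

section Labels

variable {U : Type*} [Inv U] (f : LabelledForest U)

/-- At every node of the forest, the labels of the incident edges, oriented towards that node, form
a star in `F`. There is no condition at the extra node `none`. -/
def IsOver (F : Set (Set U)) : Prop :=
  ∀ v, insert (f.label v)⁻¹ (f.childLabels (some v)) ∈ F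

/-- The label of a dart: the label of the lower end if the dart points upwards, and its inverse
otherwise. -/
noncomputable def dartLabel (d : f.graph.Dart) : U :=
  Sum.elim f.label (fun v => (f.label v)⁻¹) (f.dartEquiv.symm d)

theorem dartLabel_upDart (v : f.Node) : f.dartLabel (f.upDart v) = f.label v :=
  congrArg (Sum.elim _ _) (f.dartEquiv.symm_apply_apply (.inl v))

theorem dartLabel_upDart_symm (v : f.Node) : f.dartLabel (f.upDart v).symm = (f.label v)⁻¹ :=
  congrArg (Sum.elim _ _) (f.dartEquiv.symm_apply_apply (.inr v))

end Labels

section STree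

variable {U : Type*} [SepUniverse U] {S : Set U} {F : Set (Set U)} (f : LabelledForest U)

/-- The `S`-tree obtained from a forest with labels in `S` by joining its roots to an extra
node. -/
noncomputable def toSTree (hS : IsSepSystem S) (hf : ∀ v, f.label v ∈ S) :
    STree S (Option f.Node) where
  graph := f.graph
  isTree := f.graph_isTree
  label := f.dartLabel
  label_mem d := by
    obtain ⟨v, rfl | rfl⟩ := f.exists_eq_upDart_or_symm d
    · exact f.dartLabel_upDart v ▸ hf v
    · exact f.dartLabel_upDart_symm v ▸ hS _ (hf v)
  label_symm d := by
    obtain ⟨v, rfl | rfl⟩ := f.exists_eq_upDart_or_symm d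
    · rw [dartLabel_upDart, dartLabel_upDart_symm]
    · rw [SimpleGraph.Dart.symm_symm, dartLabel_upDart, dartLabel_upDart_symm, inv_inv]

theorem nodeLabels_toSTree (hS : IsSepSystem S) (hf : ∀ v, f.label v ∈ S) (a : Option f.Node) :
    (f.toSTree hS hf).nodeLabels a =
      f.childLabels a ∪ (fun v => (f.label v)⁻¹) '' {v | some v = a} := by
  ext x
  constructor
  · rintro ⟨d, hd, rfl⟩
    obtain ⟨v, rfl | rfl⟩ := f.exists_eq_upDart_or_symm d
    · exact Or.inl ⟨v, hd, (f.dartLabel_upDart v).symm⟩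
    · exact Or.inr ⟨v, hd, (f.dartLabel_upDart_symm v).symm⟩
  · rintro (⟨v, hv, rfl⟩ | ⟨v, hv, rfl⟩)
    · exact ⟨f.upDart v, hv, f.dartLabel_upDart v⟩
    · exact ⟨(f.upDart v).symm, hv, f.dartLabel_upDart_symm v⟩

variable {f}

theorem IsOver.label_mem (hS : IsSepSystem S) (hF : ∀ σ ∈ F, σ ⊆ S) (hf : f.IsOver F)
    (v : f.Node) : f.label v ∈ S := by
  simpa only [inv_inv] using hS _ (hF _ (hf v) (Set.mem_insert _ _))

theorem IsOver.existsSTreeOver (hS : IsSepSystem S) (hF : ∀ σ ∈ F, σ ⊆ S) (hf : f.IsOver F)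
    (hroot : f.childLabels none ∈ F) : ExistsSTreeOver S F := by
  refine ⟨Option f.Node, inferInstance, f.toSTree hS (hf.label_mem hS hF), fun a => ?_⟩
  rw [nodeLabels_toSTree]
  cases a with
  | none => simpa using hroot
  | some v => simpa only [Option.some.injEq, Set.ofPred_eq_eq_singleton, Set.image_singleton,
      Set.union_singleton] using hf v

end STree

section Gluing

variable {U : Type*}

/-- The disjoint union of a finite family of forests. -/
def sigma {ι : Type} [Finite ι] (f : ι → LabelledForest U) : LabelledForest U where
  Node := Σ i, (f i).Node
  finite := inferInstance
  parent v := ((f v.1).parent v.2).map (Sigma.mk v.1)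
  depth a := a.elim 0 fun v => (f v.1).depth (some v.2) + 1
  depth_parent_lt := by
    rintro ⟨i, v⟩
    have hlt := (f i).depth_parent_lt v
    cases h : (f i).parent v with
    | none => simp
    | some w => simpa [h] using hlt
  label v := (f v.1).label v.2

/-- The tree obtained from a forest by joining all its roots to a new root with label `x`. -/
def cons (x : U) (f : LabelledForest U) : LabelledForest U where
  Node := Option f.Node
  finite := inferInstance
  parent := Option.map f.parent
  depth a := a.elim 0 fun b => f.depth b + 1
  depth_parent_lt := by
    rintro (_ | v)
    · simp
    · simpa using f.depth_parent_lt v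
  label a := a.elim x f.label

theorem childLabels_sigma_none {ι : Type} [Finite ι] (f : ι → LabelledForest U) :
    (sigma f).childLabels none = ⋃ i, (f i).childLabels none := by
  ext x
  simp [childLabels, sigma]

theorem childLabels_sigma_some {ι : Type} [Finite ι] (f : ι → LabelledForest U) (i : ι)
    (v : (f i).Node) : (sigma f).childLabels (some ⟨i, v⟩) = (f i).childLabels (some v) := by
  ext x
  constructor
  · rintro ⟨⟨j, w⟩, hw, rfl⟩
    obtain ⟨w', hw', heq⟩ := Option.map_eq_some_iff.1 hw
    cases heq
    exact ⟨w, hw', rfl⟩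
  · rintro ⟨w, hw, rfl⟩
    exact ⟨⟨i, w⟩, Option.map_eq_some_iff.2 ⟨v, hw, rfl⟩, rfl⟩

theorem childLabels_cons_none (x : U) (f : LabelledForest U) :
    (cons x f).childLabels none = {x} := by
  ext y
  simp [childLabels, cons, eq_comm]

theorem childLabels_cons_some (x : U) (f : LabelledForest U) (a : Option f.Node) :
    (cons x f).childLabels (some a) = f.childLabels a := by
  ext y
  simp [childLabels, cons]

variable [Inv U] {F : Set (Set U)}

theorem IsOver.sigma {ι : Type} [Finite ι] {f : ι → LabelledForest U}
    (hf : ∀ i, (f i).IsOver F) : (sigma f).IsOver F := by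
  rintro ⟨i, v⟩
  rw [childLabels_sigma_some]
  exact hf i v

theorem IsOver.cons {x : U} {f : LabelledForest U} (hf : f.IsOver F)
    (hx : insert x⁻¹ (f.childLabels none) ∈ F) : (cons x f).IsOver F := by
  rintro (_ | v)
  · rwa [childLabels_cons_some]
  · rw [childLabels_cons_some]
    exact hf v

theorem exists_isOver_of_forall_singleton {A : Set U} (hA : A.Finite)
    (h : ∀ y ∈ A, ∃ f : LabelledForest U, f.IsOver F ∧ f.childLabels none = {y}) :
    ∃ f : LabelledForest U, f.IsOver F ∧ f.childLabels none = A := by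
  have := hA.to_subtype
  obtain ⟨n, ⟨e⟩⟩ := Finite.exists_equiv_fin A
  choose f hf hroot using fun i => h (e.symm i) (e.symm i).2
  refine ⟨sigma f, .sigma hf, ?_⟩
  simp only [childLabels_sigma_none, hroot]
  rw [e.symm.surjective.iUnion_comp fun y => ({(y : U)} : Set U), Set.iUnion_of_singleton_coe]

end Gluing

end LabelledForest

theorem Derives.exists_labelledForest {U : Type*} [Inv U] {F : Set (Set U)}
    (hF : ∀ σ ∈ F, σ.Finite) {x : U} (h : Derives F ∅ x) :
    ∃ f : LabelledForest U, f.IsOver F ∧ f.childLabels none = {x} := by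
  induction h with
  | leaf hp => exact hp.elim
  | @node x σ hσ hxσ _ ih =>
    obtain ⟨f, hf, hroot⟩ := LabelledForest.exists_isOver_of_forall_singleton
      ((hF σ hσ).sdiff (t := {x⁻¹})) fun y hy => ih y hy.1 hy.2
    refine ⟨f.cons x, hf.cons ?_, f.childLabels_cons_none x⟩
    rwa [hroot, Set.insert_sdiff_singleton, Set.insert_eq_of_mem hxσ]

theorem Refutes.existsSTreeOver {U : Type*} [SepUniverse U] {S : Set U} {F : Set (Set U)}
    (hfin : S.Finite) (hS : IsSepSystem S) (hF : ∀ σ ∈ F, σ ⊆ S) (h : Refutes F ∅) :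
    ExistsSTreeOver S F := by
  obtain ⟨σ, hσ, hd⟩ := h
  have hFfin : ∀ τ ∈ F, τ.Finite := fun τ hτ => hfin.subset (hF τ hτ)
  obtain ⟨f, hf, hroot⟩ := LabelledForest.exists_isOver_of_forall_singleton (hFfin σ hσ)
    fun y hy => (hd y hy).exists_labelledForest hFfin
  exact hf.existsSTreeOver hS hF (hroot ▸ hσ)

end Forests

theorem exists_sink_of_isTree {V : Type*} [Finite V] {G : SimpleGraph V} (hG : G.IsTree)
    {q : G.Dart → Prop} (hq : ∀ d, q d ∨ q d.symm) : ∃ t, ∀ d : G.Dart, d.snd = t → q d := by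
  by_contra! hno
  choose f hf_snd hf using hno
  have hinj : Function.Injective fun t => (⟨(f t).edge, (f t).edge_mem⟩ : G.edgeSet) := by
    intro t u h
    obtain h | h := (SimpleGraph.dart_edge_eq_iff _ _).1 (congrArg Subtype.val h)
    · rw [← hf_snd t, ← hf_snd u, h]
    · exact ((hq (f u)).elim (hf u) (h ▸ hf t)).elim
  have hle := Nat.card_le_card_of_injective _ hinj
  have hcard := (SimpleGraph.isTree_iff_connected_and_card.1 hG).2
  lia

theorem IsTangle.not_existsSTreeOver {U : Type*} [SepUniverse U] {S O : Set U} {F : Set (Set U)}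
    (hO : IsTangle S F O) : ¬ ExistsSTreeOver S F := by
  rintro ⟨V, _, T, hT⟩
  obtain ⟨t, ht⟩ := exists_sink_of_isTree T.isTree (q := fun d => T.label d ∈ O) fun d => by
    simpa only [T.label_symm] using hO.isOrientation.orients _ (T.label_mem d)
  exact hO.avoids _ (hT t) (Set.image_subset_iff.2 ht)

end TangleTree

theorem mainTheorem1_general {U : Type*} [TangleTree.SepUniverse U]
    (S : Set U) (hfin : S.Finite) (hS : TangleTree.IsSepSystem S)
    (F : Set (Set U)) (hstar : ∀ σ ∈ F, TangleTree.IsStar S σ)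
    (hstd : TangleTree.IsStandard S F)
    (hsep : TangleTree.IsCriticallySeparable S F) :
    Xor (TangleTree.ExistsSTreeOver S F) (∃ O : Set U, TangleTree.IsTangle S F O) := by
  refine (xor_iff_or_and_not_and _ _).2 ⟨?_, fun ⟨hT, _, hO⟩ => hO.not_existsSTreeOver hT⟩
  by_cases hF : TangleTree.Refutes F ∅
  · exact Or.inl (hF.existsSTreeOver hfin hS fun σ hσ => (hstar σ hσ).1)
  · exact Or.inr (TangleTree.exists_isTangle hfin hS hstar hstd hsep hF)

theorem mainTheorem1 {U : Type*} [TangleTree.SepUniverse U] [Finite U]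
    (S : Set U) (hS : TangleTree.IsSepSystem S)
    (F : Set (Set U)) (hstar : ∀ σ ∈ F, TangleTree.IsStar S σ)
    (hstd : TangleTree.IsStandard S F)
    (hsep : TangleTree.IsCriticallySeparable S F) :
    Xor (TangleTree.ExistsSTreeOver S F) (∃ O : Set U, TangleTree.IsTangle S F O) :=
  mainTheorem1_general S S.toFinite hS F hstar hstd hsep
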